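/- Let $A$ be a unital C*-algebra that is simple (it is nonzero and has no closed two-sided ideals other than $0$ and $A$) and tracial (its set $T(A)$ of tracial states is nonempty). Let $\varphi,\psi\colon C([0,1])\to A$ be unital $^*$-monomorphisms, and let $p\in[1,\infty]$. For Borel probability measures $\mu,\nu$ on $[0,1]$, let $\Pi(\mu,\nu)$ be the set of Borel probability measures on $[0,1]^2$ with marginals $\mu$ and $\nu$, and let $$W_p(\mu,\nu)=\inf_{\pi\in\Pi(\mu,\nu)}\left(\int |x-y|^p\,d\pi(x,y)\right)^{1/p}\quad(p<\infty),\qquad W_\infty(\mu,\nu)=\inf_{\pi\in\Pi(\mu,\nu)}\ \pi\text{-}\operatorname*{ess\,sup}_{(x,y)}|x-y| .$$ For $\tau\in T(A)$ let $\mu_{\varphi^*\tau}$ be the Borel probability measure on $[0,1]$ with $\int f\,d\mu_{\varphi^*\tau}=\tau(\varphi(f))$ for all $f\in C([0,1])$, and similarly for $\psi$. Put $$W_p(\varphi,\psi)=\sup_{\tau\in T(A)}W_p(\mu_{\varphi^*\tau},\mu_{\psi^*\tau}).$$ For $a\in A$ let $\|a\|_p=\sup_{\tau\in T(A)}\tau(|a|^p)^{1/p}$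 if $p<\infty$, and let $\|a\|_\infty=\|a\|$ be the C*-norm. Let $\mathrm{Lip}([0,1])$ be the set of functions $f\colon[0,1]\to\mathbb{R}$ with $|f(x)-f(y)|\le|x-y|$ for all $x,y$, let $\mathcal{U}(A)$ be the unitary group of $A$, and put $$d_{\mathcal{U},p}(\varphi,\psi)=\inf_{u\in\mathcal{U}(A)}\ \sup_{f\in\mathrm{Lip}([0,1])}\|u\varphi(f)u^*-\psi(f)\|_p .$$ Then $$W_p(\varphi,\psi)\le d_{\mathcal{U},p}(\varphi,\psi).$$ -/

import Mathlib

open MeasureTheory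
open scoped ENNReal ComplexOrder

namespace TracialTransport

/-- A unital C*-algebra is *simple* if it is nonzero and has no closed two-sided ideals other
than `0` and the whole algebra. -/
structure IsSimpleCStar (A : Type*) [CStarAlgebra A] : Prop where
  nontrivial : Nontrivial A
  eq_bot_or_eq_top : ∀ I : TwoSidedIdeal A, IsClosed (I : Set A) → I = ⊥ ∨ I = ⊤

/-- A tracial state on a unital C*-algebra: a positive linear functional `τ` with `τ 1 = 1` and
`τ (a * b) = τ (b * a)`. The type of these is the trace space `T(A)`. -/
structure TracialState (A : Type*) [CStarAlgebra A] [PartialOrder A] extends A →ₚ[ℂ] ℂ where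
  map_one' : toFun 1 = 1
  map_mul_comm' : ∀ a b : A, toFun (a * b) = toFun (b * a)

/-- A C*-algebra is *tracial* if it has at least one tracial state. -/
def IsTracial (A : Type*) [CStarAlgebra A] [PartialOrder A] : Prop :=
  Nonempty (TracialState A)

/-- The pullback `φ^*τ = τ ∘ φ` of a tracial state along a unital *-homomorphism. -/
noncomputable def TracialState.pullback {A B : Type*}
    [CStarAlgebra A] [PartialOrder A] [StarOrderedRing A]
    [CStarAlgebra B] [PartialOrder B] [StarOrderedRing B]
    (φ : B →⋆ₐ[ℂ] A) (τ : TracialState A) : TracialState B where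
  toPositiveLinearMap := τ.toPositiveLinearMap.comp (PositiveLinearMap.ofClass φ)
  map_one' := by
    change τ.toFun (φ 1) = 1
    rw [map_one]
    exact τ.map_one'
  map_mul_comm' a b := by
    change τ.toFun (φ (a * b)) = τ.toFun (φ (b * a))
    rw [map_mul, map_mul]
    exact τ.map_mul_comm' _ _

section Commutative

variable {X : Type*} [TopologicalSpace X]

/-- A continuous real-valued function, regarded as an element of `C(X, ℂ)`. -/
noncomputable def complexify (f : C(X, ℝ)) : C(X, ℂ) where
  toFun x := (f x : ℂ)
  continuous_toFun := Complex.continuous_ofReal.comp f.continuous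

variable [CompactSpace X]

/-- The positive real functional on real-valued functions obtained by restricting a tracial state
on `C(X, ℂ)` (on a compact space, every continuous function has compact support). -/
noncomputable def realFunctional (τ : TracialState C(X, ℂ)) :
    CompactlySupportedContinuousMap X ℝ →ₚ[ℝ] ℝ :=
  PositiveLinearMap.mk₀
    { toFun := fun f => (τ.toPositiveLinearMap (complexify f.toContinuousMap)).re
      map_add' := fun f g => by
        have : complexify (f + g).toContinuousMap
            = complexify f.toContinuousMap + complexify g.toContinuousMap := by
          ext x; simp [complexify]
        rw [this, map_add, Complex.add_re]
      map_smul' := fun c f => by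
        have : complexify (c • f).toContinuousMap
            = (c : ℂ) • complexify f.toContinuousMap := by
          ext x; simp [complexify]
        rw [this, map_smul]
        simp }
    (fun f hf => by
      have h : (0 : C(X, ℂ)) ≤ complexify f.toContinuousMap := by
        intro x
        simpa [complexify] using hf x
      exact (Complex.le_def.mp (map_nonneg τ.toPositiveLinearMap h)).1)

variable [T2Space X] [MeasurableSpace X] [BorelSpace X]

/-- The Borel measure `μ_τ` on the compact space `X` that corresponds to the tracial state `τ` of
`C(X, ℂ)` under the Riesz representation theorem. -/
noncomputable def traceMeasure (τ : TracialState C(X, ℂ)) : Measure X :=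
  RealRMK.rieszMeasure (realFunctional τ)

/-- `μ_τ` represents `τ` on real-valued functions (hence, by linearity, on `C(X, ℂ)`). -/
theorem integral_traceMeasure (τ : TracialState C(X, ℂ)) (f : C(X, ℝ)) :
    ((∫ x, f x ∂(traceMeasure τ) : ℝ) : ℂ) = τ.toPositiveLinearMap (complexify f) := by
  have h := RealRMK.integral_rieszMeasure (realFunctional τ)
    ⟨f, HasCompactSupport.of_compactSpace _⟩
  have h' : ∫ x, f x ∂(traceMeasure τ) = (τ.toPositiveLinearMap (complexify f)).re := h
  rw [h']
  have hs : IsSelfAdjoint (complexify f) := by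
    ext x; simp [complexify]
  have := hs.map' τ.toPositiveLinearMap
  exact Complex.conj_eq_iff_re.mp this

instance isProbabilityMeasure_traceMeasure (τ : TracialState C(X, ℂ)) :
    IsProbabilityMeasure (traceMeasure τ) := by
  have h := integral_traceMeasure τ 1
  have h1 : complexify (1 : C(X, ℝ)) = 1 := by ext x; simp [complexify]
  have h2 : τ.toPositiveLinearMap (1 : C(X, ℂ)) = 1 := τ.map_one'
  rw [h1, h2] at h
  have h3 : (traceMeasure τ).real Set.univ = 1 := by simpa using h
  constructor
  have h4 : traceMeasure τ Set.univ ≠ ∞ := by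
    intro h4
    simp [Measure.real, h4] at h3
  rw [← ENNReal.ofReal_toReal h4]
  change ENNReal.ofReal ((traceMeasure τ).real Set.univ) = 1
  rw [h3, ENNReal.ofReal_one]

end Commutative

/-- `Π(μ, ν)`: the Borel measures on `X × X` with marginals `μ` and `ν`. -/
def couplings {X : Type*} [MeasurableSpace X] (μ ν : Measure X) : Set (Measure (X × X)) :=
  {π | π.map Prod.fst = μ ∧ π.map Prod.snd = ν}

/-- The `p`-Wasserstein distance: the infimum over couplings `π` of the `L^p(π)`-norm of the metric.
For `1 ≤ p < ∞` this norm is `(∫ d(x,y)^p dπ)^{1/p}`; for `p = ∞` it is the `π`-essential supremum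
of `d`. -/
noncomputable def wasserstein {X : Type*} [MetricSpace X] [MeasurableSpace X]
    (p : ℝ≥0∞) (μ ν : Measure X) : ℝ≥0∞ :=
  ⨅ π ∈ couplings μ ν, eLpNorm (fun z : X × X => dist z.1 z.2) p π

section CStar

variable {A : Type*} [CStarAlgebra A] [PartialOrder A] [StarOrderedRing A]

/-- The uniform tracial Schatten `p`-norm `sup_{τ ∈ T(A)} τ(|a|^p)^{1/p}` for `p < ∞`; for `p = ∞`
it is the C*-norm. -/
noncomputable def schattenNorm (p : ℝ≥0∞) (a : A) : ℝ≥0∞ :=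
  if p = ∞ then ENNReal.ofReal ‖a‖
  else ⨆ τ : TracialState A,
    ENNReal.ofReal ((τ.toPositiveLinearMap (CFC.abs a ^ p.toReal)).re ^ (1 / p.toReal))

variable {X : Type*} [MetricSpace X] [CompactSpace X]

/-- `Lip(X)`: the real-valued functions `f` on `X` with `|f x - f y| ≤ d(x, y)`. -/
def lip (X : Type*) [MetricSpace X] : Set C(X, ℝ) :=
  {f | ∀ x y : X, |f x - f y| ≤ dist x y}

/-- The Schatten-`p` unitary distance
`inf_{u ∈ U(A)} sup_{f ∈ Lip(X)} ‖u φ(f) u^* - ψ(f)‖_p`. Since `A` is unital, it is its own minimal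
unitization. -/
noncomputable def unitaryDist (p : ℝ≥0∞) (φ ψ : C(X, ℂ) →⋆ₐ[ℂ] A) : ℝ≥0∞ :=
  ⨅ u : unitary A, ⨆ f ∈ lip X,
    schattenNorm p ((u : A) * φ (complexify f) * star (u : A) - ψ (complexify f))

/-- The tracial Wasserstein distance
`sup_{τ ∈ T(A)} W_p(μ_{φ^*τ}, μ_{ψ^*τ})`. -/
noncomputable def tracialWasserstein [MeasurableSpace X] [BorelSpace X]
    (p : ℝ≥0∞) (φ ψ : C(X, ℂ) →⋆ₐ[ℂ] A) : ℝ≥0∞ :=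
  ⨆ τ : TracialState A,
    wasserstein p (traceMeasure (τ.pullback φ)) (traceMeasure (τ.pullback ψ))

end CStar

end TracialTransport

/-! Fix a trace τ and a unitary u. Testing the supremum over Lipschitz functions at the coordinate x
alone suffices. Put a = uφ(x)u* and b = ψ(x). Since τ is unitarily invariant, the distributions of a
and b under τ are the two measures to be compared. Coupling them through their quantile functions
bounds W_p by the L^p(0,1) norm of the difference of the quantiles, so it remains to bound that norm
by the p-norm of a - b, a tracial analogue of the Lidskii–Mirsky eigenvalue inequalities.

The engine is monotonicity: if a ≤ b, then τ(f(a)) ≤ τ(f(b)) for every increasing C¹ function f,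
operator monotone or not, because traciality gives d/dt τ(f(a + tc)) = τ(f'(a + tc)c) for
polynomials (`TracialState.reCLM_cfc_mono`). Smoothed step functions f then show that quantiles
increase with the element (`TracialState.HasDistribution.measure_Ioi_le`).

For p = ∞, apply this to a ≤ b + ‖a - b‖. For p < ∞, apply it to a ≤ b + k + d and b + k ≤ b + k + d
with d = (a - b - k)₊; integrating the quantiles bounds the hinge integral of the quantile
difference at level k by τ(d) (`TracialState.HasDistribution.lintegral_hinge_quantile_sub_le`). As
x₊^p is a positive mixture of the hinges (x - k)₊ with k > 0 when p > 1, and is itself a hinge when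
p = 1, the p-th power bound follows, the negative part being handled by exchanging a and b. -/

namespace TracialTransport

open Polynomial Set Filter Topology

/-! ### Monotonicity of the trace under increasing functional calculus. -/

section TraceMonotone

variable {A : Type*} [CStarAlgebra A] [PartialOrder A] [StarOrderedRing A]

/-- The real part of a tracial state, as a continuous real-linear functional. -/
noncomputable def TracialState.reCLM (τ : TracialState A) : A →L[ℝ] ℝ where
  toFun a := (τ.toPositiveLinearMap a).re
  map_add' a b := by simp
  map_smul' c a := by
    rw [← Complex.coe_smul, map_smul]
    simp
  cont := Complex.continuous_re.comp (map_continuous τ.toPositiveLinearMap)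

theorem TracialState.reCLM_apply (τ : TracialState A) (a : A) :
    τ.reCLM a = (τ.toPositiveLinearMap a).re := rfl

theorem TracialState.reCLM_one (τ : TracialState A) : τ.reCLM 1 = 1 := by
  have h : τ.toPositiveLinearMap 1 = 1 := τ.map_one'
  rw [reCLM_apply, h, Complex.one_re]

theorem TracialState.reCLM_mul_comm (τ : TracialState A) (a b : A) :
    τ.reCLM (a * b) = τ.reCLM (b * a) :=
  congrArg Complex.re (τ.map_mul_comm' a b)

theorem TracialState.reCLM_nonneg (τ : TracialState A) {a : A} (ha : 0 ≤ a) : 0 ≤ τ.reCLM a :=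
  (Complex.le_def.mp (map_nonneg τ.toPositiveLinearMap ha)).1

theorem TracialState.reCLM_mono (τ : TracialState A) {a b : A} (h : a ≤ b) :
    τ.reCLM a ≤ τ.reCLM b := by
  have := τ.reCLM_nonneg (sub_nonneg.mpr h)
  rwa [map_sub, sub_nonneg] at this

/-- A tracial state is nonnegative on products of two positive elements. -/
theorem TracialState.reCLM_mul_nonneg (τ : TracialState A) {a b : A} (ha : 0 ≤ a) (hb : 0 ≤ b) :
    0 ≤ τ.reCLM (a * b) := by
  -- With s = √a, traciality gives τ(ssb) = τ(sbs), and sbs is positive although ab need not be.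
  have hs : 0 ≤ CFC.sqrt a := CFC.sqrt_nonneg a
  rw [← CFC.sqrt_mul_sqrt_self a ha, mul_assoc, τ.reCLM_mul_comm]
  exact τ.reCLM_nonneg (hs.isSelfAdjoint.conjugate_nonneg hb)

/-- The noncommutative product rule yields n terms with c in different slots; cyclicity of the trace
moves c to the end of each, making them all equal. -/
theorem TracialState.hasDerivAt_reCLM_pow (τ : TracialState A) (a c : A) (n : ℕ) (t : ℝ) :
    HasDerivAt (fun t : ℝ => τ.reCLM ((a + t • c) ^ n))
      (n * τ.reCLM ((a + t • c) ^ (n - 1) * c)) t := by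
  have h1 : HasDerivAt (fun t : ℝ => a + t • c) c t := by
    simpa using ((hasDerivAt_id t).smul_const c).const_add a
  have h2 := ((hasStrictFDerivAt_pow' (𝕜 := ℝ) n (x := a + t • c)).hasFDerivAt).comp_hasDerivAt t h1
  have h3 := τ.reCLM.hasFDerivAt.comp_hasDerivAt t h2
  refine h3.congr_deriv (Eq.symm ?_)
  simp only [_root_.sum_apply, map_sum, _root_.smul_apply,
    ContinuousLinearMap.id_apply, MulOpposite.smul_eq_mul_unop, MulOpposite.unop_op, smul_eq_mul]
  rw [Finset.sum_congr rfl (g := fun _ => τ.reCLM ((a + t • c) ^ (n - 1) * c))]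
  · simp
  · intro i hi
    rw [τ.reCLM_mul_comm, ← mul_assoc, ← pow_add]
    have := Finset.mem_range.mp hi
    congr 3
    simp only [Nat.pred_eq_sub_one]
    omega

theorem TracialState.hasDerivAt_reCLM_aeval (τ : TracialState A) (a c : A) (P : ℝ[X]) (t : ℝ) :
    HasDerivAt (fun t : ℝ => τ.reCLM (aeval (a + t • c) P))
      (τ.reCLM (aeval (a + t • c) (derivative P) * c)) t := by
  induction P using Polynomial.induction_on' with
  | add p q hp hq =>
    simp only [map_add, add_mul]
    exact hp.add hq
  | monomial n r =>
    have h := (τ.hasDerivAt_reCLM_pow a c n t).const_mul r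
    simp only [derivative_monomial, aeval_monomial, ← Algebra.smul_def, map_smul, smul_eq_mul,
      smul_mul_assoc]
    exact h.congr_deriv (by ring)

theorem mem_Icc_of_mem_spectrum {A : Type*} [CStarAlgebra A] {a : A} {M x : ℝ} (ha : ‖a‖ ≤ M)
    (hx : x ∈ spectrum ℝ a) : x ∈ Icc (-M) M := by
  rw [mem_Icc, ← abs_le, ← Real.norm_eq_abs]
  have : Nontrivial A := by
    by_contra h
    rw [not_nontrivial_iff_subsingleton] at h
    simp [spectrum.of_subsingleton] at hx
  exact (spectrum.norm_le_norm_of_mem hx).trans ha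

theorem aeval_nonneg_of_spectrum {a : A} (ha : IsSelfAdjoint a) {P : ℝ[X]}
    (hP : ∀ x ∈ spectrum ℝ a, 0 ≤ P.eval x) : 0 ≤ aeval a P := by
  rw [← cfc_polynomial P a]
  exact cfc_nonneg hP

/-- Along the segment from a to b the derivative is the trace of a product of two positive elements,
P' at the moving point and b - a. Convexity of the norm ball keeps the spectrum in [-M, M], where P'
is nonnegative. -/
theorem TracialState.reCLM_aeval_mono (τ : TracialState A) {a b : A} (ha : IsSelfAdjoint a)
    (hb : IsSelfAdjoint b) (hab : a ≤ b) {M : ℝ} (haM : ‖a‖ ≤ M) (hbM : ‖b‖ ≤ M) {P : ℝ[X]}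
    (hP : ∀ x ∈ Icc (-M) M, 0 ≤ (derivative P).eval x) :
    τ.reCLM (aeval a P) ≤ τ.reCLM (aeval b P) := by
  have hd := τ.hasDerivAt_reCLM_aeval a (b - a) P
  have hmono : MonotoneOn (fun t : ℝ => τ.reCLM (aeval (a + t • (b - a)) P)) (Icc 0 1) := by
    refine monotoneOn_of_deriv_nonneg (convex_Icc 0 1)
      (fun t _ => (hd t).continuousAt.continuousWithinAt)
      (fun t _ => (hd t).differentiableAt.differentiableWithinAt) fun t ht => ?_
    rw [interior_Icc] at ht
    rw [(hd t).deriv]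
    refine τ.reCLM_mul_nonneg ?_ (sub_nonneg.mpr hab)
    have hsa : IsSelfAdjoint (a + t • (b - a)) := ha.add ((IsSelfAdjoint.all t).smul (hb.sub ha))
    refine aeval_nonneg_of_spectrum hsa fun x hx => hP x (mem_Icc_of_mem_spectrum ?_ hx)
    have : a + t • (b - a) = (1 - t) • a + t • b := by module
    rw [this]
    calc ‖(1 - t) • a + t • b‖ ≤ ‖(1 - t) • a‖ + ‖t • b‖ := norm_add_le _ _
      _ = (1 - t) * ‖a‖ + t * ‖b‖ := by
        rw [norm_smul, norm_smul, Real.norm_of_nonneg ht.1.le,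
          Real.norm_of_nonneg (sub_nonneg.mpr ht.2.le)]
      _ ≤ (1 - t) * M + t * M := by
        have := sub_nonneg.mpr ht.2.le
        have := ht.1.le
        gcongr
      _ = M := by ring
  have := hmono (left_mem_Icc.mpr zero_le_one) (right_mem_Icc.mpr zero_le_one) zero_le_one
  simpa using this

theorem exists_derivative_eq (q : ℝ[X]) : ∃ P : ℝ[X], derivative P = q := by
  induction q using Polynomial.induction_on' with
  | add p q hp hq =>
    obtain ⟨P, rfl⟩ := hp
    obtain ⟨Q, rfl⟩ := hq
    exact ⟨P + Q, derivative_add⟩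
  | monomial n r =>
    refine ⟨monomial (n + 1) (r / (n + 1)), ?_⟩
    rw [derivative_monomial, Nat.add_sub_cancel]
    congr 1
    push_cast
    field_simp

/-- A continuously differentiable increasing function is uniformly approximated on a compact
interval by polynomials which are increasing on that interval. -/
theorem exists_polynomial_near_of_deriv_nonneg {f f' : ℝ → ℝ} (hf : ∀ x, HasDerivAt f (f' x) x)
    (hc : Continuous f') (h0 : ∀ x, 0 ≤ f' x) {M : ℝ} (hM : 0 ≤ M) {ε : ℝ} (hε : 0 < ε) :
    ∃ P : ℝ[X], (∀ x ∈ Icc (-M) M, 0 ≤ (derivative P).eval x) ∧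
      ∀ x ∈ Icc (-M) M, |P.eval x - f x| ≤ ε := by
  -- Approximating f' + δ within δ keeps the polynomial derivative nonnegative and within 2δ of f'.
  -- Integrating from 0 over a length at most M costs less than ε; M + 1 covers M = 0.
  set δ := ε / (2 * (M + 1)) with hδ
  have hδ0 : 0 < δ := by positivity
  obtain ⟨q, hq⟩ := exists_polynomial_near_of_continuousOn (-M) M (fun x => f' x + δ)
    (by fun_prop) δ hδ0
  obtain ⟨Q, rfl⟩ := exists_derivative_eq q
  refine ⟨Q + C (f 0 - Q.eval 0), fun x hx => ?_, fun x hx => ?_⟩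
  · have := abs_lt.mp (hq x hx)
    simp only [derivative_add, derivative_C, add_zero]
    linarith [h0 x]
  · have hx0 : (0 : ℝ) ∈ Icc (-M) M := ⟨by linarith, hM⟩
    have hd : ∀ y ∈ Icc (-M) M, HasDerivWithinAt (fun y => Q.eval y - f y)
        ((derivative Q).eval y - f' y) (Icc (-M) M) y := fun y _ =>
      ((Q.hasDerivAt y).sub (hf y)).hasDerivWithinAt
    have hb : ∀ y ∈ Icc (-M) M, ‖(derivative Q).eval y - f' y‖ ≤ 2 * δ := fun y hy => by
      have := abs_lt.mp (hq y hy)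
      rw [Real.norm_eq_abs, abs_le]
      constructor <;> linarith
    have h := (convex_Icc (-M) M).norm_image_sub_le_of_norm_hasDerivWithin_le hd hb hx0 hx
    simp only [Real.norm_eq_abs, sub_zero] at h
    simp only [eval_add, eval_C]
    have hxM : |x| ≤ M := abs_le.mpr hx
    calc |Q.eval x + (f 0 - Q.eval 0) - f x| = |Q.eval x - f x - (Q.eval 0 - f 0)| := by
          congr 1; ring
      _ ≤ 2 * δ * |x| := h
      _ ≤ 2 * δ * (M + 1) := by gcongr; linarith
      _ = ε := by rw [hδ]; field_simp

/-- The trace is monotone under continuously differentiable increasing functional calculus. -/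
theorem TracialState.reCLM_cfc_mono (τ : TracialState A) {a b : A} (ha : IsSelfAdjoint a)
    (hb : IsSelfAdjoint b) (hab : a ≤ b) {f f' : ℝ → ℝ} (hf : ∀ x, HasDerivAt f (f' x) x)
    (hc : Continuous f') (h0 : ∀ x, 0 ≤ f' x) :
    τ.reCLM (cfc f a) ≤ τ.reCLM (cfc f b) := by
  have hfc : Continuous f := continuous_iff_continuousAt.mpr fun x => (hf x).continuousAt
  set M := max ‖a‖ ‖b‖
  have hM : 0 ≤ M := (norm_nonneg a).trans (le_max_left _ _)
  -- A uniform error ε on the spectrum costs at most ε in the trace, as τ is positive and τ(1) = 1.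
  have key : ∀ (P : ℝ[X]) (ε : ℝ), (∀ x ∈ Icc (-M) M, |P.eval x - f x| ≤ ε) →
      ∀ c : A, IsSelfAdjoint c → ‖c‖ ≤ M →
        |τ.reCLM (aeval c P) - τ.reCLM (cfc f c)| ≤ ε := by
    intro P ε hP c hc hcM
    have hbd : ∀ x ∈ spectrum ℝ c, |P.eval x - f x| ≤ ε := fun x hx =>
      hP x (mem_Icc_of_mem_spectrum hcM hx)
    have hPc : Continuous fun x => P.eval x := P.continuous
    have hu : τ.reCLM (cfc (fun x => P.eval x) c) ≤ τ.reCLM (cfc (fun x => f x + ε) c) :=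
      τ.reCLM_mono (cfc_mono (fun x hx => by linarith [(abs_le.mp (hbd x hx)).2]))
    have hl : τ.reCLM (cfc f c) ≤ τ.reCLM (cfc (fun x => P.eval x + ε) c) :=
      τ.reCLM_mono (cfc_mono (fun x hx => by linarith [(abs_le.mp (hbd x hx)).1]))
    rw [cfc_add_const _ _ _, Algebra.algebraMap_eq_smul_one, map_add, map_smul, τ.reCLM_one,
      smul_eq_mul, mul_one] at hu hl
    rw [← cfc_polynomial P c, abs_le]
    constructor <;> linarith
  refine le_of_forall_pos_le_add fun ε hε => ?_
  obtain ⟨P, hP, hPf⟩ := exists_polynomial_near_of_deriv_nonneg hf hc h0 hM (half_pos hε)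
  have h1 := τ.reCLM_aeval_mono ha hb hab (le_max_left _ _) (le_max_right _ _) hP
  have h2 := abs_le.mp (key P _ hPf a ha (le_max_left _ _))
  have h3 := abs_le.mp (key P _ hPf b hb (le_max_right _ _))
  linarith [h2.1, h3.2]

end TraceMonotone

end TracialTransport

namespace TracialTransport

open Set Filter Topology

/-! ### Distributions of self-adjoint elements and stochastic order. -/

section Distribution

variable {A : Type*} [CStarAlgebra A] [PartialOrder A] [StarOrderedRing A]

/-- `μ` is the distribution of the self-adjoint element `a` with respect to the tracial
state `τ`. -/
def TracialState.HasDistribution (τ : TracialState A) (a : A) (μ : Measure ℝ) : Prop :=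
  ∀ f : ℝ → ℝ, Continuous f → Integrable f μ ∧ ∫ x, f x ∂μ = τ.reCLM (cfc f a)

theorem TracialState.HasDistribution.isProbabilityMeasure {τ : TracialState A} {a : A}
    {μ : Measure ℝ} (h : τ.HasDistribution a μ) (ha : IsSelfAdjoint a) :
    IsProbabilityMeasure μ := by
  obtain ⟨h1, h2⟩ := h (fun _ => 1) continuous_const
  have hfin : IsFiniteMeasure μ := by
    rcases integrable_const_iff.mp h1 with h | h
    · exact absurd h one_ne_zero
    · exact h
  rw [cfc_const_one ℝ a, τ.reCLM_one] at h2
  have h3 : μ.real univ = 1 := by simpa using h2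
  exact ⟨by rw [← ofReal_measureReal (measure_ne_top μ univ), h3, ENNReal.ofReal_one]⟩

/-- The functional `f ↦ τ (f a)` on continuous functions on the spectrum of `a`. -/
noncomputable def TracialState.spectralFunctional (τ : TracialState A) {a : A}
    (ha : IsSelfAdjoint a) :
    CompactlySupportedContinuousMap (spectrum ℝ a) ℝ →ₚ[ℝ] ℝ :=
  PositiveLinearMap.mk₀
    { toFun := fun f => τ.reCLM (cfcHom ha f.toContinuousMap)
      map_add' := fun f g => by
        have : (f + g).toContinuousMap = f.toContinuousMap + g.toContinuousMap := rfl
        rw [this, map_add, map_add]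
      map_smul' := fun c f => by
        have : (c • f).toContinuousMap = c • f.toContinuousMap := rfl
        rw [this, map_smul, map_smul, RingHom.id_apply] }
    (fun f hf => τ.reCLM_nonneg (by
      have : (0 : C(spectrum ℝ a, ℝ)) ≤ f.toContinuousMap := fun x => hf x
      exact (cfcHom_nonneg_iff ha).mpr this))

/-- Riesz representation on the compact spectrum, pushed forward to the line. -/
theorem TracialState.exists_hasDistribution (τ : TracialState A) {a : A}
    (ha : IsSelfAdjoint a) : ∃ μ : Measure ℝ, τ.HasDistribution a μ := by
  refine ⟨(RealRMK.rieszMeasure (τ.spectralFunctional ha)).map Subtype.val, fun f hf => ?_⟩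
  have : CompactSpace (spectrum ℝ a) := inferInstance
  have hme : MeasurableEmbedding (Subtype.val : spectrum ℝ a → ℝ) :=
    MeasurableEmbedding.subtype_coe (spectrum.isClosed a).measurableSet
  have hi := RealRMK.integral_rieszMeasure (τ.spectralFunctional ha)
    ⟨⟨fun x => f x, by fun_prop⟩, HasCompactSupport.of_compactSpace _⟩
  rw [hme.integrable_map_iff, hme.integral_map, cfc_apply f a ha hf.continuousOn]
  refine ⟨?_, hi⟩
  have hc : Continuous (f ∘ (Subtype.val : spectrum ℝ a → ℝ)) := by fun_prop
  exact hc.integrable_of_hasCompactSupport (HasCompactSupport.of_compactSpace _)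

theorem TracialState.HasDistribution.map_add_const {τ : TracialState A} {a : A} {μ : Measure ℝ}
    (h : τ.HasDistribution a μ) (ha : IsSelfAdjoint a) (k : ℝ) :
    τ.HasDistribution (a + algebraMap ℝ A k) (μ.map (· + k)) := by
  intro f hf
  have hme : MeasurableEmbedding (fun x : ℝ => x + k) := measurableEmbedding_addRight k
  obtain ⟨h1, h2⟩ := h (fun x => f (x + k)) (by fun_prop)
  rw [hme.integrable_map_iff, hme.integral_map]
  refine ⟨h1, h2.trans ?_⟩
  have : a + algebraMap ℝ A k = cfc (fun x => x + k) a := by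
    rw [cfc_add_const k (fun x => x) a, cfc_id' ℝ a]
  rw [this, ← cfc_comp f (fun x => x + k) a]
  rfl

/-- Larger elements have stochastically larger distributions. -/
theorem TracialState.HasDistribution.measure_Ioi_le {τ : TracialState A} {a b : A}
    {μ ν : Measure ℝ} (hμ : τ.HasDistribution a μ) (hν : τ.HasDistribution b ν)
    (ha : IsSelfAdjoint a) (hb : IsSelfAdjoint b) (hab : a ≤ b) (s : ℝ) :
    μ (Ioi s) ≤ ν (Ioi s) := by
  have := hμ.isProbabilityMeasure ha
  have := hν.isProbabilityMeasure hb
  -- Increasing smooth steps converging pointwise to the indicator of (s, ∞); smoothness makes trace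
  -- monotonicity applicable to each.
  set g : ℕ → ℝ → ℝ := fun n x => Real.smoothTransition (n * (x - s)) with hg
  have hgc : ∀ n, Continuous (g n) := fun n =>
    Real.smoothTransition.continuous.comp (by fun_prop)
  have hlim : ∀ (ρ : Measure ℝ) [IsProbabilityMeasure ρ],
      Tendsto (fun n => ∫ x, g n x ∂ρ) atTop (𝓝 (ρ.real (Ioi s))) := by
    intro ρ _
    rw [← integral_indicator_one measurableSet_Ioi]
    refine tendsto_integral_of_dominated_convergence (fun _ => 1)
      (fun n => (hgc n).aestronglyMeasurable) (integrable_const _) (fun n => ae_of_all _ fun x => ?_)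
      (ae_of_all _ fun x => ?_)
    · rw [Real.norm_of_nonneg (Real.smoothTransition.nonneg _)]
      exact Real.smoothTransition.le_one _
    · by_cases hx : x ∈ Ioi s
      · rw [indicator_of_mem hx, Pi.one_apply]
        have hx' : 0 < x - s := sub_pos.mpr hx
        refine tendsto_const_nhds.congr' ?_
        filter_upwards [eventually_ge_atTop ⌈(x - s)⁻¹⌉₊] with n hn
        have hn' : (x - s)⁻¹ ≤ n := (Nat.le_ceil _).trans (by exact_mod_cast hn)
        refine (Real.smoothTransition.one_of_one_le ?_).symm
        calc (1 : ℝ) = (x - s)⁻¹ * (x - s) := (inv_mul_cancel₀ hx'.ne').symm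
          _ ≤ n * (x - s) := by gcongr
      · rw [indicator_of_notMem hx]
        refine tendsto_const_nhds.congr fun n => (Real.smoothTransition.zero_of_nonpos ?_).symm
        exact mul_nonpos_of_nonneg_of_nonpos n.cast_nonneg (by simpa using hx)
  have hle : μ.real (Ioi s) ≤ ν.real (Ioi s) := by
    refine le_of_tendsto_of_tendsto' (hlim μ) (hlim ν) fun n => ?_
    rw [(hμ _ (hgc n)).2, (hν _ (hgc n)).2]
    have hcd : ContDiff ℝ 1 (g n) :=
      (Real.smoothTransition.contDiff (n := 1)).comp (by fun_prop)
    have hmono : Monotone (g n) := Real.smoothTransition.monotone.comp fun x y hxy => by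
      gcongr
    exact τ.reCLM_cfc_mono ha hb hab
      (fun x => ((hcd.differentiable one_ne_zero) x).hasDerivAt)
      (hcd.continuous_deriv le_rfl) fun x => hmono.deriv_nonneg
  exact (ENNReal.toReal_le_toReal (measure_ne_top _ _) (measure_ne_top _ _)).mp hle

end Distribution

/-! ### Quantile functions on (0, 1). -/

section Quantile

/-- The quantile function of a probability measure on the line. -/
noncomputable def quantile (μ : Measure ℝ) (t : ℝ) : ℝ :=
  sInf {x | t ≤ μ.real (Iic x)}

variable {μ ν : Measure ℝ} [IsProbabilityMeasure μ] [IsProbabilityMeasure ν]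

/-- The Galois connection between quantile and distribution function: t > 0 bounds the defining set
below, t < 1 makes it nonempty, and right continuity shows that the infimum is attained. -/
theorem quantile_le_iff {t : ℝ} (ht : t ∈ Ioo (0 : ℝ) 1) (x : ℝ) :
    quantile μ t ≤ x ↔ t ≤ μ.real (Iic x) := by
  simp only [quantile, ← ProbabilityTheory.cdf_eq_real]
  have hbdd : BddBelow {x | t ≤ ProbabilityTheory.cdf μ x} := by
    obtain ⟨y, hy⟩ := ((ProbabilityTheory.tendsto_cdf_atBot μ).eventually_lt_const ht.1).exists
    refine ⟨y, fun z hz => le_of_not_gt fun hzy => ?_⟩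
    exact absurd (hz.trans (ProbabilityTheory.monotone_cdf μ hzy.le)) (not_le.mpr hy)
  have hne : {x | t ≤ ProbabilityTheory.cdf μ x}.Nonempty := by
    obtain ⟨y, hy⟩ := ((ProbabilityTheory.tendsto_cdf_atTop μ).eventually_const_lt ht.2).exists
    exact ⟨y, hy.le⟩
  refine ⟨fun h => ?_, fun h => csInf_le hbdd h⟩
  have hright := ((ProbabilityTheory.cdf μ).right_continuous x).mono Ioi_subset_Ici_self
  refine ge_of_tendsto hright ?_
  filter_upwards [self_mem_nhdsWithin] with y hy
  obtain ⟨z, hz, hzy⟩ := exists_lt_of_csInf_lt hne (lt_of_le_of_lt h hy)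
  exact le_trans hz (ProbabilityTheory.monotone_cdf μ hzy.le)

theorem monotoneOn_quantile : MonotoneOn (quantile μ) (Ioo 0 1) := fun _ hs _ ht hst =>
  (quantile_le_iff hs _).mpr (hst.trans ((quantile_le_iff ht _).mp le_rfl))

theorem aemeasurable_quantile : AEMeasurable (quantile μ) (volume.restrict (Ioo 0 1)) :=
  aemeasurable_restrict_of_monotoneOn measurableSet_Ioo monotoneOn_quantile

instance isProbabilityMeasure_volume_Ioo :
    IsProbabilityMeasure (volume.restrict (Ioo (0 : ℝ) 1)) :=
  ⟨by simp⟩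

theorem map_quantile : (volume.restrict (Ioo 0 1)).map (quantile μ) = μ := by
  have : IsProbabilityMeasure ((volume.restrict (Ioo 0 1)).map (quantile μ)) :=
    Measure.isProbabilityMeasure_map aemeasurable_quantile
  refine Measure.ext_of_Iic _ _ fun x => ?_
  rw [Measure.map_apply_of_aemeasurable aemeasurable_quantile measurableSet_Iic]
  have h1 : (volume.restrict (Ioo 0 1)) (quantile μ ⁻¹' Iic x)
      = (volume.restrict (Ioo 0 1)) (Iic (μ.real (Iic x))) := by
    refine measure_congr ?_
    filter_upwards [ae_restrict_mem measurableSet_Ioo] with t ht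
    exact propext (quantile_le_iff ht x)
  -- Adding the null endpoint 1 makes the intersection with a closed lower ray a half-open interval
  -- in every case.
  have h2 : volume.restrict (Ioo (0 : ℝ) 1) = volume.restrict (Ioc 0 1) :=
    Measure.restrict_congr_set Ioo_ae_eq_Ioc
  rw [h1, h2, Measure.restrict_apply measurableSet_Iic, inter_comm, Ioc_inter_Iic,
    min_eq_right measureReal_le_one, Real.volume_Ioc, sub_zero, ofReal_measureReal]

theorem quantile_le_quantile (h : ∀ s, μ (Ioi s) ≤ ν (Ioi s)) {t : ℝ} (ht : t ∈ Ioo (0 : ℝ) 1) :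
    quantile μ t ≤ quantile ν t := by
  rw [quantile_le_iff ht]
  refine ((quantile_le_iff (μ := ν) ht _).mp le_rfl).trans ?_
  rw [← compl_Ioi, probReal_compl_eq_one_sub measurableSet_Ioi,
    probReal_compl_eq_one_sub measurableSet_Ioi]
  have := ENNReal.toReal_mono (measure_ne_top ν _) (h (quantile ν t))
  simp only [Measure.real]
  linarith

theorem quantile_map_add_const (k : ℝ) {t : ℝ} (ht : t ∈ Ioo (0 : ℝ) 1) :
    quantile (μ.map (· + k)) t = quantile μ t + k := by
  have hm : Measurable (fun x : ℝ => x + k) := by fun_prop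
  have : IsProbabilityMeasure (μ.map (· + k)) :=
    Measure.isProbabilityMeasure_map hm.aemeasurable
  refine eq_of_forall_ge_iff fun x => ?_
  rw [quantile_le_iff ht, ← le_sub_iff_add_le, quantile_le_iff ht,
    map_measureReal_apply hm measurableSet_Iic]
  congr! 2
  ext y
  simp [le_sub_iff_add_le]

end Quantile

end TracialTransport

namespace TracialTransport

open Set Filter Topology

/-! ### Powers as mixtures of hinge functions. -/

section Hinge

/-- Taylor's formula with integral remainder for x^p at 0: the kernel p(p - 1)k^(p-2) is the second
derivative, integrable at 0 because p > 1. -/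
theorem lintegral_rpow_mul_hinge {p : ℝ} (hp : 1 < p) (x : ℝ) :
    ENNReal.ofReal x ^ p = ENNReal.ofReal (p * (p - 1)) *
      ∫⁻ k in Ioi (0 : ℝ), ENNReal.ofReal (k ^ (p - 2)) * ENNReal.ofReal (x - k) := by
  rcases le_or_gt x 0 with hx | hx
  · rw [setLIntegral_congr_fun (g := fun _ => 0) measurableSet_Ioi fun k hk => ?_]
    · rw [ENNReal.ofReal_of_nonpos hx, ENNReal.zero_rpow_of_pos (by linarith)]
      simp
    · have hk' : 0 < k := hk
      simp only [ENNReal.ofReal_of_nonpos (show x - k ≤ 0 by linarith), mul_zero]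
  have hsplit : ∫⁻ k in Ioi (0 : ℝ), ENNReal.ofReal (k ^ (p - 2)) * ENNReal.ofReal (x - k)
      = ∫⁻ k in Ioc 0 x, ENNReal.ofReal (k ^ (p - 2) * (x - k)) := by
    rw [← Ioc_union_Ioi_eq_Ioi hx.le, lintegral_union measurableSet_Ioi
      (Ioc_disjoint_Ioi le_rfl)]
    rw [setLIntegral_congr_fun (s := Ioi x) (g := fun _ => 0) measurableSet_Ioi fun k hk => ?_]
    · rw [lintegral_zero, add_zero]
      refine setLIntegral_congr_fun measurableSet_Ioc fun k hk => ?_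
      rw [ENNReal.ofReal_mul (Real.rpow_nonneg hk.1.le _)]
    · have hk' : x < k := hk
      simp only [ENNReal.ofReal_of_nonpos (show x - k ≤ 0 by linarith), mul_zero]
  have hi1 : IntervalIntegrable (fun k : ℝ => k ^ (p - 2) * x) volume 0 x :=
    (intervalIntegral.intervalIntegrable_rpow' (by linarith)).mul_const x
  have hi2 : IntervalIntegrable (fun k : ℝ => k ^ (p - 1)) volume 0 x :=
    intervalIntegral.intervalIntegrable_rpow' (by linarith)
  have hcongr : EqOn (fun k : ℝ => k ^ (p - 2) * (x - k))
      (fun k => k ^ (p - 2) * x - k ^ (p - 1)) (Ioc 0 x) := fun k hk => by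
    have : k ^ (p - 1) = k ^ (p - 2) * k := by
      rw [← Real.rpow_add_one hk.1.ne']; congr 1; ring
    simp only [this]
    ring
  have hint : ∫ k in Ioc 0 x, k ^ (p - 2) * (x - k) = x ^ p / (p * (p - 1)) := by
    rw [setIntegral_congr_fun measurableSet_Ioc hcongr, ← intervalIntegral.integral_of_le hx.le,
      intervalIntegral.integral_sub hi1 hi2, intervalIntegral.integral_mul_const,
      integral_rpow (Or.inl (by linarith)), integral_rpow (Or.inl (by linarith)),
      show p - 2 + 1 = p - 1 by ring, show p - 1 + 1 = p by ring,
      Real.zero_rpow (by linarith), Real.zero_rpow (by linarith),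
      show x ^ p = x ^ (p - 1) * x by rw [← Real.rpow_add_one hx.ne']; congr 1; ring]
    have h1 : p ≠ 0 := by linarith
    have h2 : p - 1 ≠ 0 := by linarith
    field_simp
    ring
  have hI : IntegrableOn (fun k : ℝ => k ^ (p - 2) * (x - k)) (Ioc 0 x) :=
    (integrableOn_congr_fun hcongr measurableSet_Ioc).mpr
      ((intervalIntegrable_iff_integrableOn_Ioc_of_le hx.le).mp (hi1.sub hi2))
  have hpp : 0 < p * (p - 1) := mul_pos (by linarith) (by linarith)
  rw [hsplit, ← ofReal_integral_eq_lintegral_ofReal hI, hint, ← ENNReal.ofReal_mul hpp.le,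
    mul_div_cancel₀ _ hpp.ne', ENNReal.ofReal_rpow_of_nonneg hx.le (by linarith)]
  filter_upwards [ae_restrict_mem measurableSet_Ioc] with k hk
  exact mul_nonneg (Real.rpow_nonneg hk.1.le _) (sub_nonneg.mpr hk.2)

/-- Domination of all hinge functions implies domination of all powers of the positive part. -/
theorem lintegral_ofReal_rpow_le_of_hinge {μ ν : Measure ℝ} [SFinite μ] [SFinite ν]
    (h : ∀ k : ℝ, 0 ≤ k → ∫⁻ x, ENNReal.ofReal (x - k) ∂μ ≤ ∫⁻ x, ENNReal.ofReal (x - k) ∂ν)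
    {p : ℝ} (hp : 1 ≤ p) :
    ∫⁻ x, ENNReal.ofReal x ^ p ∂μ ≤ ∫⁻ x, ENNReal.ofReal x ^ p ∂ν := by
  rcases hp.eq_or_lt with rfl | hp
  -- At p = 1 the kernel degenerates, but the power is itself the hinge at level 0.
  · simpa using h 0 le_rfl
  have key : ∀ ρ : Measure ℝ, SFinite ρ → ∫⁻ x, ENNReal.ofReal x ^ p ∂ρ =
      ENNReal.ofReal (p * (p - 1)) * ∫⁻ k in Ioi (0 : ℝ), ENNReal.ofReal (k ^ (p - 2)) *
        ∫⁻ x, ENNReal.ofReal (x - k) ∂ρ := by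
    intro ρ _
    have hm : Measurable (fun z : ℝ × ℝ =>
        ENNReal.ofReal (z.2 ^ (p - 2)) * ENNReal.ofReal (z.1 - z.2)) := by fun_prop
    simp_rw [lintegral_rpow_mul_hinge hp]
    rw [lintegral_const_mul' _ _ ENNReal.ofReal_ne_top, lintegral_lintegral_swap hm.aemeasurable]
    congr 1
    refine lintegral_congr fun k => ?_
    rw [lintegral_const_mul' _ _ ENNReal.ofReal_ne_top]
  rw [key μ inferInstance, key ν inferInstance]
  refine mul_le_mul_right (setLIntegral_mono' measurableSet_Ioi fun k hk => ?_) _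
  exact mul_le_mul_right (h k (le_of_lt hk)) _

end Hinge

/-! ### Quantile differences bounded by the trace of a difference. -/

section QuantileDifference

variable {A : Type*} [CStarAlgebra A] [PartialOrder A] [StarOrderedRing A]

theorem TracialState.HasDistribution.integral_quantile {τ : TracialState A} {a : A}
    {μ : Measure ℝ} (h : τ.HasDistribution a μ) (ha : IsSelfAdjoint a) :
    Integrable (quantile μ) (volume.restrict (Ioo 0 1)) ∧
      ∫ t in Ioo 0 1, quantile μ t = τ.reCLM a := by
  have := h.isProbabilityMeasure ha
  obtain ⟨h1, h2⟩ := h (fun x => x) continuous_id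
  rw [cfc_id' ℝ a] at h2
  rw [← map_quantile (μ := μ)] at h1 h2
  rw [integrable_map_measure (by fun_prop) aemeasurable_quantile] at h1
  rw [integral_map aemeasurable_quantile (by fun_prop)] at h2
  exact ⟨h1, h2⟩

theorem TracialState.HasDistribution.quantile_mono {τ : TracialState A} {a b : A}
    {μ ν : Measure ℝ} (hμ : τ.HasDistribution a μ) (hν : τ.HasDistribution b ν)
    (ha : IsSelfAdjoint a) (hb : IsSelfAdjoint b) (hab : a ≤ b) {t : ℝ} (ht : t ∈ Ioo (0 : ℝ) 1) :
    quantile μ t ≤ quantile ν t := by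
  have := hμ.isProbabilityMeasure ha
  have := hν.isProbabilityMeasure hb
  exact quantile_le_quantile (hμ.measure_Ioi_le hν ha hb hab) ht

theorem TracialState.HasDistribution.quantile_le_add_norm_sub {τ : TracialState A} {a b : A}
    {μ ν : Measure ℝ} (hμ : τ.HasDistribution a μ) (hν : τ.HasDistribution b ν)
    (ha : IsSelfAdjoint a) (hb : IsSelfAdjoint b) {t : ℝ} (ht : t ∈ Ioo (0 : ℝ) 1) :
    quantile μ t ≤ quantile ν t + ‖a - b‖ := by
  have := hν.isProbabilityMeasure hb
  rw [← quantile_map_add_const _ ht]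
  refine hμ.quantile_mono (hν.map_add_const hb _) ha (hb.add (.algebraMap A (.all _))) ?_ ht
  rw [add_comm, ← sub_le_iff_le_add]
  exact (ha.sub hb).le_algebraMap_norm_self

/-- Weak submajorization of the difference of two quantile functions. -/
theorem TracialState.HasDistribution.lintegral_hinge_quantile_sub_le {τ : TracialState A}
    {a b : A} {μ ν : Measure ℝ} (hμ : τ.HasDistribution a μ) (hν : τ.HasDistribution b ν)
    (ha : IsSelfAdjoint a) (hb : IsSelfAdjoint b) (k : ℝ) :
    ∫⁻ t in Ioo 0 1, ENNReal.ofReal (quantile μ t - quantile ν t - k) ≤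
      ENNReal.ofReal (τ.reCLM (cfc (fun x => max (x - k) 0) (a - b))) := by
  have hνp := hν.isProbabilityMeasure hb
  set c := a - b with hc
  have hcs : IsSelfAdjoint c := ha.sub hb
  set d := cfc (fun x => max (x - k) 0) c with hd
  have hd0 : 0 ≤ d := cfc_nonneg fun x _ => le_max_right _ _
  set b' := b + algebraMap ℝ A k with hb'
  have hbs' : IsSelfAdjoint b' := hb.add (.algebraMap A (.all _))
  have hν' := hν.map_add_const hb k
  have hes : IsSelfAdjoint (b' + d) := hbs'.add hd0.isSelfAdjoint
  obtain ⟨ρ, hρ⟩ := τ.exists_hasDistribution hes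
  have hae : a ≤ b' + d := by
    have h : c ≤ d + algebraMap ℝ A k := by
      rw [hd, ← cfc_add_const k (fun x => max (x - k) 0) c]
      nth_rewrite 1 [← cfc_id' ℝ c]
      exact cfc_mono fun x _ => by linarith [le_max_left (x - k) 0]
    calc a = b + c := by rw [hc]; abel
      _ ≤ b + (d + algebraMap ℝ A k) := by gcongr
      _ = b' + d := by rw [hb']; abel
  obtain ⟨hi1, he1⟩ := hρ.integral_quantile hes
  obtain ⟨hi2, he2⟩ := hν'.integral_quantile hbs'
  -- Replacing a by the larger b' + d makes the quantile difference nonnegative, since also b' ≤ b'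
  -- + d. The positive part can then be dropped, and the integral telescopes to τ(b' + d) - τ(b') =
  -- τ(d).
  calc ∫⁻ t in Ioo 0 1, ENNReal.ofReal (quantile μ t - quantile ν t - k)
      ≤ ∫⁻ t in Ioo 0 1, ENNReal.ofReal (quantile ρ t - quantile (ν.map (· + k)) t) := by
        refine setLIntegral_mono' measurableSet_Ioo fun t ht => ENNReal.ofReal_le_ofReal ?_
        rw [quantile_map_add_const k ht]
        linarith [hμ.quantile_mono hρ ha hes hae ht]
    _ = ENNReal.ofReal (∫ t in Ioo 0 1, (quantile ρ t - quantile (ν.map (· + k)) t)) := by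
        refine (ofReal_integral_eq_lintegral_ofReal (hi1.sub hi2) ?_).symm
        filter_upwards [ae_restrict_mem measurableSet_Ioo] with t ht
        exact sub_nonneg.mpr
          (hν'.quantile_mono hρ hbs' hes (le_add_of_nonneg_right hd0) ht)
    _ = ENNReal.ofReal (τ.reCLM d) := by
        rw [integral_sub hi1 hi2, he1, he2, map_add, add_sub_cancel_left]

theorem TracialState.HasDistribution.ofReal_reCLM_cfc {τ : TracialState A} {a : A}
    {μ : Measure ℝ} (h : τ.HasDistribution a μ) {f : ℝ → ℝ} (hf : Continuous f)
    (h0 : ∀ x, 0 ≤ f x) :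
    ENNReal.ofReal (τ.reCLM (cfc f a)) = ∫⁻ x, ENNReal.ofReal (f x) ∂μ := by
  rw [← (h f hf).2, ofReal_integral_eq_lintegral_ofReal (h f hf).1 (ae_of_all _ h0)]

/-- The `L^p`-distance of the quantile functions of `a` and `b` is at most the tracial `p`-norm of
`a - b`. -/
theorem TracialState.HasDistribution.lintegral_quantile_sub_rpow_le {τ : TracialState A}
    {a b : A} {μ ν : Measure ℝ} (hμ : τ.HasDistribution a μ) (hν : τ.HasDistribution b ν)
    (ha : IsSelfAdjoint a) (hb : IsSelfAdjoint b) {p : ℝ} (hp : 1 ≤ p) :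
    ∫⁻ t in Ioo 0 1, ENNReal.ofReal |quantile μ t - quantile ν t| ^ p ≤
      ENNReal.ofReal (τ.reCLM (cfc (fun x : ℝ => |x| ^ p) (a - b))) := by
  have hμp := hμ.isProbabilityMeasure ha
  have hνp := hν.isProbabilityMeasure hb
  have hcs : IsSelfAdjoint (a - b) := ha.sub hb
  have hp0 : 0 < p := by linarith
  obtain ⟨ρ, hρ⟩ := τ.exists_hasDistribution hcs
  have hρp := hρ.isProbabilityMeasure hcs
  have hD : AEMeasurable (fun t => quantile μ t - quantile ν t) (volume.restrict (Ioo 0 1)) :=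
    aemeasurable_quantile.sub aemeasurable_quantile
  have hD' : AEMeasurable (fun t => quantile ν t - quantile μ t) (volume.restrict (Ioo 0 1)) :=
    aemeasurable_quantile.sub aemeasurable_quantile
  have habs : ∀ x : ℝ, ENNReal.ofReal |x| ^ p = ENNReal.ofReal x ^ p + ENNReal.ofReal (-x) ^ p := by
    intro x
    rcases le_total 0 x with hx | hx
    · rw [abs_of_nonneg hx, ENNReal.ofReal_of_nonpos (show -x ≤ 0 by linarith),
        ENNReal.zero_rpow_of_pos hp0, add_zero]
    · rw [abs_of_nonpos hx, ENNReal.ofReal_of_nonpos hx, ENNReal.zero_rpow_of_pos hp0, zero_add]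
  have hmax : ∀ x : ℝ, ENNReal.ofReal (max x 0) = ENNReal.ofReal x := fun x => by
    simp [ENNReal.ofReal_max]
  have hpos : ∫⁻ t in Ioo 0 1, ENNReal.ofReal (quantile μ t - quantile ν t) ^ p ≤
      ∫⁻ x, ENNReal.ofReal x ^ p ∂ρ := by
    have := lintegral_ofReal_rpow_le_of_hinge (μ := (volume.restrict (Ioo 0 1)).map
      (fun t => quantile μ t - quantile ν t)) (ν := ρ) (fun k _ => ?_) hp
    · rwa [lintegral_map' (by fun_prop) hD] at this
    · rw [lintegral_map' (by fun_prop) hD]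
      refine (hμ.lintegral_hinge_quantile_sub_le hν ha hb k).trans_eq ?_
      rw [hρ.ofReal_reCLM_cfc (by fun_prop) fun x => le_max_right _ _]
      simp_rw [hmax]
  -- The same bound with a and b exchanged; b - a has the reflected distribution of a - b.
  have hneg : ∫⁻ t in Ioo 0 1, ENNReal.ofReal (quantile ν t - quantile μ t) ^ p ≤
      ∫⁻ x, ENNReal.ofReal (-x) ^ p ∂ρ := by
    have := lintegral_ofReal_rpow_le_of_hinge (μ := (volume.restrict (Ioo 0 1)).map
      (fun t => quantile ν t - quantile μ t)) (ν := ρ.map Neg.neg) (fun k _ => ?_) hp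
    · rwa [lintegral_map' (by fun_prop) hD', lintegral_map (by fun_prop) measurable_neg] at this
    · rw [lintegral_map' (by fun_prop) hD', lintegral_map (by fun_prop) measurable_neg]
      refine (hν.lintegral_hinge_quantile_sub_le hμ hb ha k).trans_eq ?_
      rw [← neg_sub a b, ← cfc_comp_neg (fun x => max (x - k) 0) (a - b),
        hρ.ofReal_reCLM_cfc (f := fun x => max (-x - k) 0) (by fun_prop) fun x => le_max_right _ _]
      simp_rw [hmax]
  have hc : Continuous fun x : ℝ => |x| ^ p := continuous_abs.rpow_const fun _ => Or.inr hp0.le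
  rw [hρ.ofReal_reCLM_cfc hc fun x => Real.rpow_nonneg (abs_nonneg x) p]
  simp_rw [← ENNReal.ofReal_rpow_of_nonneg (abs_nonneg _) hp0.le, habs, neg_sub]
  rw [lintegral_add_left' (hD.ennreal_ofReal.pow_const p), lintegral_add_left (by fun_prop)]
  exact add_le_add hpos hneg

end QuantileDifference

end TracialTransport

namespace TracialTransport

open Set

/-! ### Couplings on the unit interval and the link to the p-norms. -/

section UnitInterval

/-- The inclusion of the unit interval into the line. -/
def coordinate : C(unitInterval, ℝ) := ⟨Subtype.val, continuous_subtype_val⟩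

theorem isSelfAdjoint_complexify {X : Type*} [TopologicalSpace X] (f : C(X, ℝ)) :
    IsSelfAdjoint (complexify f) := by
  ext x
  simp [complexify]

theorem coordinate_mem_lip : coordinate ∈ lip unitInterval := fun _ _ => le_rfl

/-- Each point evaluation is a continuous *-homomorphism, so it commutes with the functional
calculus and reduces the claim to scalars. -/
theorem cfc_complexify {X : Type*} [TopologicalSpace X] [CompactSpace X] (g : C(X, ℝ))
    (f : C(ℝ, ℝ)) :
    cfc (fun z : ℂ => (f z.re : ℂ)) (complexify g) = complexify (f.comp g) := by
  ext x
  have hs := (isSelfAdjoint_complexify g).isStarNormal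
  have h := StarAlgHomClass.map_cfc (S := ℂ) (ContinuousMap.evalStarAlgHom ℂ ℂ x)
    (fun z : ℂ => (f z.re : ℂ)) (complexify g) (by fun_prop)
    (continuous_eval_const x) hs (hs.map _)
  refine h.trans ((cfc_algebraMap (A := ℂ) (g x : ℂ) _).trans ?_)
  simp [complexify]

variable {A : Type*} [CStarAlgebra A] [PartialOrder A] [StarOrderedRing A]

theorem TracialState.hasDistribution_coordinate (τ : TracialState A)
    (φ : C(unitInterval, ℂ) →⋆ₐ[ℂ] A) :
    τ.HasDistribution (φ (complexify coordinate))
      ((traceMeasure (τ.pullback φ)).map Subtype.val) := by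
  intro f hf
  have hme : MeasurableEmbedding (Subtype.val : unitInterval → ℝ) :=
    MeasurableEmbedding.subtype_coe measurableSet_Icc
  have hc : Continuous (f ∘ (Subtype.val : unitInterval → ℝ)) := hf.comp continuous_subtype_val
  rw [hme.integrable_map_iff, hme.integral_map]
  refine ⟨hc.integrable_of_hasCompactSupport (HasCompactSupport.of_compactSpace _), ?_⟩
  have h := integral_traceMeasure (τ.pullback φ) ((⟨f, hf⟩ : C(ℝ, ℝ)).comp coordinate)
  have hs := isSelfAdjoint_complexify coordinate
  have hmap : cfc f (φ (complexify coordinate)) =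
      φ (complexify ((⟨f, hf⟩ : C(ℝ, ℝ)).comp coordinate)) := by
    rw [cfc_real_eq_complex f (hs.map φ), ← cfc_complexify]
    exact (StarAlgHomClass.map_cfc (S := ℂ) φ _ _
      (Complex.continuous_ofReal.comp (hf.comp Complex.continuous_re)).continuousOn
      (map_continuous φ) hs.isStarNormal (hs.map φ).isStarNormal).symm
  rw [hmap]
  exact congrArg Complex.re h

/-- Conjugation by u is a *-automorphism preserving the trace; this is why the bound is uniform over
unitaries. -/
theorem TracialState.HasDistribution.conj_unitary {τ : TracialState A} {a : A} {μ : Measure ℝ}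
    (h : τ.HasDistribution a μ) (ha : IsSelfAdjoint a) (u : unitary A) :
    τ.HasDistribution ((u : A) * a * star (u : A)) μ := by
  intro f hf
  refine ⟨(h f hf).1, (h f hf).2.trans ?_⟩
  have hmap := StarAlgHomClass.map_cfc (S := ℂ) (Unitary.conjStarAlgAut ℂ A u) f a
    hf.continuousOn (by
      change Continuous fun x : A => (u : A) * x * star (u : A)
      fun_prop) ha (ha.map _)
  simp only [Unitary.conjStarAlgAut_apply] at hmap
  rw [← hmap, τ.reCLM_mul_comm, ← mul_assoc, Unitary.coe_star_mul_self, one_mul]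

/-- The monotone coupling of two measures on the unit interval. -/
noncomputable def monotoneCoupling (μ ν : Measure unitInterval) :
    Measure (unitInterval × unitInterval) :=
  (volume.restrict (Ioo 0 1)).map fun t : ℝ =>
    (projIcc (0 : ℝ) 1 zero_le_one (quantile (μ.map Subtype.val) t),
      projIcc (0 : ℝ) 1 zero_le_one (quantile (ν.map Subtype.val) t))

theorem isProbabilityMeasure_map_val (μ : Measure unitInterval) [IsProbabilityMeasure μ] :
    IsProbabilityMeasure (μ.map Subtype.val) :=
  Measure.isProbabilityMeasure_map measurable_subtype_coe.aemeasurable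

theorem aemeasurable_projIcc_quantile (μ : Measure unitInterval) [IsProbabilityMeasure μ] :
    AEMeasurable (fun t => projIcc (0 : ℝ) 1 zero_le_one (quantile (μ.map Subtype.val) t))
      (volume.restrict (Ioo 0 1)) := by
  have := isProbabilityMeasure_map_val μ
  exact continuous_projIcc.measurable.comp_aemeasurable aemeasurable_quantile

theorem map_projIcc_quantile (μ : Measure unitInterval) [IsProbabilityMeasure μ] :
    (volume.restrict (Ioo 0 1)).map
      (fun t => projIcc (0 : ℝ) 1 zero_le_one (quantile (μ.map Subtype.val) t)) = μ := by
  have := isProbabilityMeasure_map_val μ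
  have hp : Measurable (projIcc (0 : ℝ) 1 zero_le_one) := continuous_projIcc.measurable
  have h := AEMeasurable.map_map_of_aemeasurable (μ := volume.restrict (Ioo 0 1))
    (f := quantile (μ.map Subtype.val)) hp.aemeasurable aemeasurable_quantile
  rw [map_quantile, Measure.map_map hp measurable_subtype_coe] at h
  refine h.symm.trans ?_
  have hid : projIcc (0 : ℝ) 1 zero_le_one ∘ (Subtype.val : unitInterval → ℝ) = id :=
    funext fun x => projIcc_val _ x
  rw [hid, Measure.map_id]

theorem monotoneCoupling_mem_couplings (μ ν : Measure unitInterval) [IsProbabilityMeasure μ]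
    [IsProbabilityMeasure ν] : monotoneCoupling μ ν ∈ couplings μ ν := by
  have hm := (aemeasurable_projIcc_quantile μ).prodMk (aemeasurable_projIcc_quantile ν)
  constructor
  · rw [monotoneCoupling, AEMeasurable.map_map_of_aemeasurable measurable_fst.aemeasurable hm]
    exact map_projIcc_quantile μ
  · rw [monotoneCoupling, AEMeasurable.map_map_of_aemeasurable measurable_snd.aemeasurable hm]
    exact map_projIcc_quantile ν

/-- The Wasserstein distance is at most the `L^p`-distance of the quantile functions. -/
theorem wasserstein_le_eLpNorm_quantile_sub (μ ν : Measure unitInterval) [IsProbabilityMeasure μ]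
    [IsProbabilityMeasure ν] (p : ℝ≥0∞) :
    wasserstein p μ ν ≤
      eLpNorm (fun t => quantile (μ.map Subtype.val) t - quantile (ν.map Subtype.val) t) p
        (volume.restrict (Ioo 0 1)) := by
  refine (iInf₂_le _ (monotoneCoupling_mem_couplings μ ν)).trans ?_
  rw [monotoneCoupling, eLpNorm_map_measure (by fun_prop)
    ((aemeasurable_projIcc_quantile μ).prodMk (aemeasurable_projIcc_quantile ν))]
  -- Clamping to [0, 1] is 1-Lipschitz, so it is not necessary to know that the quantiles already
  -- lie there.
  refine eLpNorm_mono fun t => ?_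
  rw [Function.comp_apply, Real.norm_of_nonneg dist_nonneg, Real.norm_eq_abs]
  exact abs_projIcc_sub_projIcc zero_le_one

theorem cfc_abs_rpow {c : A} (hc : IsSelfAdjoint c) {p : ℝ} (hp : 0 ≤ p) :
    CFC.abs c ^ p = cfc (fun x : ℝ => |x| ^ p) c := by
  have hcont : Continuous fun x : ℝ => x ^ p := continuous_id.rpow_const fun _ => Or.inr hp
  rw [CFC.rpow_eq_cfc_real (CFC.abs_nonneg c), CFC.abs_eq_cfc_norm c,
    ← cfc_comp (fun x : ℝ => x ^ p) (fun x : ℝ => ‖x‖) c hc hcont.continuousOn]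
  rfl

theorem eLpNorm_quantile_sub_le_schattenNorm {τ : TracialState A} {a b : A} {μ ν : Measure ℝ}
    (hμ : τ.HasDistribution a μ) (hν : τ.HasDistribution b ν)
    (ha : IsSelfAdjoint a) (hb : IsSelfAdjoint b) {p : ℝ≥0∞} (hp : 1 ≤ p) :
    eLpNorm (fun t => quantile μ t - quantile ν t) p (volume.restrict (Ioo 0 1)) ≤
      schattenNorm p (a - b) := by
  by_cases htop : p = ∞
  · rw [schattenNorm, if_pos htop, htop, eLpNorm_exponent_top]
    refine eLpNormEssSup_le_of_ae_bound ?_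
    filter_upwards [ae_restrict_mem measurableSet_Ioo] with t ht
    have h1 := hμ.quantile_le_add_norm_sub hν ha hb ht
    have h2 := hν.quantile_le_add_norm_sub hμ hb ha ht
    rw [norm_sub_rev] at h2
    rw [Real.norm_eq_abs, abs_le]
    constructor <;> linarith
  · have hp0 : p ≠ 0 := (zero_lt_one.trans_le hp).ne'
    have hp1 : 1 ≤ p.toReal := by simpa using ENNReal.toReal_mono htop hp
    have hpos : 0 ≤ p.toReal := zero_le_one.trans hp1
    rw [schattenNorm, if_neg htop, eLpNorm_eq_lintegral_rpow_enorm_toReal hp0 htop]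
    refine le_trans ?_ (le_iSup _ τ)
    rw [cfc_abs_rpow (ha.sub hb) hpos, ← τ.reCLM_apply, ← ENNReal.ofReal_rpow_of_nonneg
      (τ.reCLM_nonneg (cfc_nonneg fun x _ => Real.rpow_nonneg (abs_nonneg x) _)) (by positivity)]
    refine ENNReal.rpow_le_rpow ?_ (by positivity)
    simp_rw [← ofReal_norm, Real.norm_eq_abs]
    exact hμ.lintegral_quantile_sub_rpow_le hν ha hb hp1

end UnitInterval

end TracialTransport

theorem corollary2p4 {A : Type*} [CStarAlgebra A] [PartialOrder A] [StarOrderedRing A]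
    (hsimple : TracialTransport.IsSimpleCStar A) (htracial : TracialTransport.IsTracial A)
    (φ ψ : C(unitInterval, ℂ) →⋆ₐ[ℂ] A)
    (hφ : Function.Injective φ) (hψ : Function.Injective ψ)
    (p : ℝ≥0∞) (hp : 1 ≤ p) :
    TracialTransport.tracialWasserstein p φ ψ ≤ TracialTransport.unitaryDist p φ ψ := by
  open TracialTransport in
  refine iSup_le fun τ => le_iInf fun u => ?_
  have hs := isSelfAdjoint_complexify coordinate
  -- The coordinate generates C([0,1]), so its image alone determines the pulled-back measure.
  refine le_trans ?_ (le_iSup₂ coordinate coordinate_mem_lip)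
  refine (wasserstein_le_eLpNorm_quantile_sub _ _ p).trans ?_
  exact eLpNorm_quantile_sub_le_schattenNorm
    ((τ.hasDistribution_coordinate φ).conj_unitary (hs.map φ) u) (τ.hasDistribution_coordinate ψ)
    ((hs.map φ).conjugate (u : A)) (hs.map ψ) hp
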